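/- Let $G$ be a connected, infinite, locally finite simple graph (every vertex has finite degree). For a vertex $u$, let $N(u)$ be its set of neighbours and $d(u)=|N(u)|$ its degree, and let $d(u,v)$ be the distance between the vertices $u$ and $v$. Suppose that $G$ is an $L_1$-graph, that is, $$d(u)+d(v)\ \ge\ |N(u)\cup N(v)\cup N(w)|-1$$ for all vertices $u,v,w$ with $d(u,v)=2$ and $w\in N(u)\cap N(v)$, and suppose that $|N(u)\cap N(v)|\ge 2$ for every pair of vertices $u,v$ with $d(u,v)=2$. Then for every pair of vertices $x,y$ of $G$ with $N(x)\cap N(y)=\emptyset$ and every integer $m\ge d(x,y)+1$, there is a path in $G$ from $x$ to $y$ with exactly $m$ or exactly $m-1$ vertices. -/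

import Mathlib

/-- A locally finite graph `G` is an `L_i`-graph if
`d(u) + d(v) ≥ |N(u) ∪ N(v) ∪ N(w)| - i` for all vertices `u`, `w`, `v` with `d(u, v) = 2` and
`w ∈ N(u) ∩ N(v)`.  The number `i` is moved to the left-hand side, which avoids truncated
subtraction; the union of neighbourhoods is finite, so `Set.ncard` is its true cardinality. -/
def SimpleGraph.IsLGraph {V : Type*} (G : SimpleGraph V) [G.LocallyFinite] (i : ℕ) : Prop :=
  ∀ u w v : V, G.dist u v = 2 → w ∈ G.neighborSet u ∩ G.neighborSet v →
    G.degree u + G.degree v + i ≥ (G.neighborSet u ∪ G.neighborSet v ∪ G.neighborSet w).ncard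

namespace SimpleGraph

variable {V : Type*} {G : SimpleGraph V} {x y : V}

/-! Starting from a geodesic, it suffices to lengthen any path by one or two edges
(`HasPath.prolong`). Suppose a path cannot be lengthened, and let `v` be off it, adjacent to some `p
j` but not to `y`. Bounding `|N(p j) \ (N(v) ∪ N(p (j+1)))|` from both sides and summing over all
such `j` makes every bound tight. This forces the neighbours of `v` on the path to descend in steps
of two (`adj_sub_two`), hence to include `x` and `p 2`.

Then `v` can replace `p 1`, and the same analysis of the new path shows that `v` has no neighbour
off the path. By reversal this also holds when `v` is adjacent to `y`, as it is then not adjacent to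
`x`. So the path together with `N(x) ∪ N(y)` is finite and closed under adjacency, impossible in an
infinite connected graph. -/

/-- There is a path from `x` to `y` with exactly `n` edges. -/
def HasPath (G : SimpleGraph V) (x y : V) (n : ℕ) : Prop :=
  ∃ p : G.Walk x y, p.IsPath ∧ p.length = n

lemma HasPath.symm {n : ℕ} (h : G.HasPath x y n) : G.HasPath y x n := by
  obtain ⟨p, hp, hn⟩ := h
  exact ⟨p.reverse, hp.reverse, by simpa using hn⟩

/-! ### Paths as vertex lists and as sequences -/

/-- The list `l` is the vertex list of a walk from `a` to `b`. -/
structure Threads (G : SimpleGraph V) (l : List V) (a b : V) : Prop where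
  chain : l.IsChain G.Adj
  head : l.head? = some a
  last : l.getLast? = some b

namespace Threads

lemma single (a : V) : G.Threads [a] a a := ⟨by simp, by simp, by simp⟩

lemma append {l m : List V} {a b c d : V} (h : G.Threads l a b) (hbc : G.Adj b c)
    (h' : G.Threads m c d) : G.Threads (l ++ m) a d := by
  refine ⟨List.isChain_append.2 ⟨h.chain, h'.chain, ?_⟩, ?_, ?_⟩
  · intro u hu w hw
    rw [h.last] at hu
    rw [h'.head] at hw
    simp only [Option.mem_def, Option.some.injEq] at hu hw
    exact hu ▸ hw ▸ hbc
  · simp [h.head]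
  · simp [h'.last]

lemma reverse {l : List V} {a b : V} (h : G.Threads l a b) : G.Threads l.reverse b a := by
  refine ⟨List.isChain_reverse.2 (h.chain.imp fun _ _ hab => hab.symm), ?_, ?_⟩
  · simp [h.last]
  · simp [h.head]

lemma hasPath {l : List V} (h : G.Threads l x y) (hl : l.Nodup) {n : ℕ}
    (hn : l.length = n + 1) : G.HasPath x y n := by
  have hne : l ≠ [] := by rintro rfl; simp at hn
  have h1 : l.head hne = x := by
    have := h.head
    rwa [List.head?_eq_some_head hne, Option.some.injEq] at this
  have h2 : l.getLast hne = y := by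
    have := h.last
    rwa [List.getLast?_eq_some_getLast hne, Option.some.injEq] at this
  refine ⟨(Walk.ofSupport l hne h.chain).copy h1 h2, ?_, ?_⟩
  · rw [Walk.isPath_def]
    simpa using hl
  · simp [hn]

end Threads

/-- The vertices `p 0, …, p n` form a path from `x` to `y`. -/
structure IsPathSeq (G : SimpleGraph V) (x y : V) (p : ℕ → V) (n : ℕ) : Prop where
  zero : p 0 = x
  last : p n = y
  adj : ∀ i < n, G.Adj (p i) (p (i + 1))
  inj : ∀ i ≤ n, ∀ j ≤ n, p i = p j → i = j

/-- The list `p i, …, p j`. -/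
def seg (p : ℕ → V) (i j : ℕ) : List V := (List.range' i (j + 1 - i)).map p

lemma seg_append (p : ℕ → V) {i j k : ℕ} (hij : i ≤ j + 1) (hjk : j ≤ k) :
    seg p i j ++ seg p (j + 1) k = seg p i k := by
  unfold seg
  rw [← List.map_append]
  congr 1
  have h1 : j + 1 = i + (j + 1 - i) := by omega
  have h2 : k + 1 - i = (j + 1 - i) + (k + 1 - (j + 1)) := by omega
  rw [h2, ← List.range'_append_1, ← h1]

lemma seg_self (p : ℕ → V) (i : ℕ) : seg p i i = [p i] := by
  simp [seg]

lemma length_seg (p : ℕ → V) (i j : ℕ) : (seg p i j).length = j + 1 - i := by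
  simp [seg]

lemma mem_seg {p : ℕ → V} {i j : ℕ} {v : V} :
    v ∈ seg p i j ↔ ∃ k, i ≤ k ∧ k ≤ j ∧ p k = v := by
  simp only [seg, List.mem_map, List.mem_range'_1]
  constructor
  · rintro ⟨k, hk, rfl⟩
    exact ⟨k, by omega, by omega, rfl⟩
  · rintro ⟨k, h1, h2, rfl⟩
    exact ⟨k, by omega, rfl⟩

/-! ### Lengthening a path by rearranging its segments -/

namespace IsPathSeq

variable {p : ℕ → V} {n : ℕ}

lemma threads_seg (hp : G.IsPathSeq x y p n) {i j : ℕ} (hij : i ≤ j) (hj : j ≤ n) :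
    G.Threads (seg p i j) (p i) (p j) := by
  induction j, hij using Nat.le_induction with
  | base => rw [seg_self]; exact .single _
  | succ j hij ih =>
    rw [← seg_append p (by omega) (Nat.le_succ j), seg_self]
    exact (ih (by omega)).append (hp.adj j (by omega)) (.single _)

lemma nodup_seg (hp : G.IsPathSeq x y p n) : (seg p 0 n).Nodup := by
  refine List.Nodup.map_on ?_ List.nodup_range'
  intro i hi j hj
  rw [List.mem_range'_1] at hi hj
  exact hp.inj i (by omega) j (by omega)

lemma reverse (hp : G.IsPathSeq x y p n) : G.IsPathSeq y x (fun i => p (n - i)) n := by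
  refine ⟨by simpa using hp.last, by simpa using hp.zero, fun i hi => ?_, fun i hi j hj h => ?_⟩
  · have := hp.adj (n - (i + 1)) (by omega)
    rw [show n - (i + 1) + 1 = n - i by omega] at this
    exact this.symm
  · have := hp.inj _ (by omega) _ (by omega) h
    omega

/-- A list which threads from `x` to `y` and rearranges the path together with one new vertex. -/
lemma hasPath_of_perm (hp : G.IsPathSeq x y p n) {v : V} (hv : ∀ i ≤ n, p i ≠ v) {l : List V}
    (hl : G.Threads l x y) (hperm : l.Perm (v :: seg p 0 n)) : G.HasPath x y (n + 1) := by
  refine hl.hasPath (hperm.nodup_iff.2 (List.nodup_cons.2 ⟨?_, hp.nodup_seg⟩)) ?_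
  · rw [mem_seg]
    rintro ⟨k, -, hk, rfl⟩
    exact hv k hk rfl
  · simp [hperm.length_eq, length_seg]

lemma hasPath_of_perm_two (hp : G.IsPathSeq x y p n) {u v : V} (hu : ∀ i ≤ n, p i ≠ u)
    (hv : ∀ i ≤ n, p i ≠ v) (huv : u ≠ v) {l : List V} (hl : G.Threads l x y)
    (hperm : l.Perm (u :: v :: seg p 0 n)) : G.HasPath x y (n + 2) := by
  refine hl.hasPath (hperm.nodup_iff.2
    (List.nodup_cons.2 ⟨?_, List.nodup_cons.2 ⟨?_, hp.nodup_seg⟩⟩)) ?_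
  · rw [List.mem_cons, mem_seg]
    rintro (h | ⟨k, -, hk, rfl⟩)
    · exact huv h
    · exact hu k hk rfl
  · rw [mem_seg]
    rintro ⟨k, -, hk, rfl⟩
    exact hv k hk rfl
  · simp [hperm.length_eq, length_seg]

lemma threads_zero (hp : G.IsPathSeq x y p n) {i : ℕ} (hi : i ≤ n) :
    G.Threads (seg p 0 i) x (p i) := hp.zero ▸ hp.threads_seg (Nat.zero_le i) hi

lemma threads_last (hp : G.IsPathSeq x y p n) {i : ℕ} (hi : i ≤ n) :
    G.Threads (seg p i n) (p i) y := by
  simpa only [hp.last] using hp.threads_seg hi le_rfl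

lemma hasPath_insert (hp : G.IsPathSeq x y p n) {v : V} (hv : ∀ i ≤ n, p i ≠ v) {i : ℕ}
    (hi : i < n) (h1 : G.Adj v (p i)) (h2 : G.Adj v (p (i + 1))) : G.HasPath x y (n + 1) := by
  classical
  refine hp.hasPath_of_perm hv (l := seg p 0 i ++ ([v] ++ seg p (i + 1) n))
    ((hp.threads_zero hi.le).append h1.symm ((Threads.single v).append h2 (hp.threads_last hi))) ?_
  rw [← seg_append p (Nat.zero_le (i + 1)) hi.le, List.perm_iff_count]
  intro a
  simp only [List.count_append, List.count_cons, List.count_nil]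
  omega

lemma hasPath_insert_two (hp : G.IsPathSeq x y p n) {u v : V} (hu : ∀ i ≤ n, p i ≠ u)
    (hv : ∀ i ≤ n, p i ≠ v) {i : ℕ} (hi : i < n) (h1 : G.Adj u (p i)) (huv : G.Adj u v)
    (h2 : G.Adj v (p (i + 1))) : G.HasPath x y (n + 2) := by
  classical
  refine hp.hasPath_of_perm_two hu hv huv.ne
    (l := seg p 0 i ++ ([u] ++ ([v] ++ seg p (i + 1) n)))
    ((hp.threads_zero hi.le).append h1.symm ((Threads.single u).append huv
      ((Threads.single v).append h2 (hp.threads_last hi)))) ?_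
  rw [← seg_append p (Nat.zero_le (i + 1)) hi.le, List.perm_iff_count]
  intro a
  simp only [List.count_append, List.count_cons, List.count_nil]
  omega

/-- Go from `p i` through `v` to `p j`, back along the path to `p (i + 1)`, then jump to `p (j +
1)`. -/
lemma hasPath_of_adj_succ (hp : G.IsPathSeq x y p n) {v : V} (hv : ∀ i ≤ n, p i ≠ v) {i j : ℕ}
    (hij : i < j) (hj : j < n) (h1 : G.Adj v (p i)) (h2 : G.Adj v (p j))
    (h : G.Adj (p (i + 1)) (p (j + 1))) : G.HasPath x y (n + 1) := by
  classical
  refine hp.hasPath_of_perm hv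
    (l := seg p 0 i ++ ([v] ++ ((seg p (i + 1) j).reverse ++ seg p (j + 1) n)))
    ((hp.threads_zero (by omega)).append h1.symm ((Threads.single v).append h2
      ((hp.threads_seg hij hj.le).reverse.append h (hp.threads_last hj)))) ?_
  rw [← seg_append p (Nat.zero_le (i + 1)) (by omega : i ≤ n),
    ← seg_append p (by omega : i + 1 ≤ j + 1) hj.le, List.perm_iff_count]
  intro a
  simp only [List.count_append, List.count_cons, List.count_nil, List.count_reverse]
  omega

/-- The chord past `p (i + 1)` frees that vertex, which is put back together with `v` between `p j`
and `p (j + 1)`. -/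
lemma hasPath_move_right (hp : G.IsPathSeq x y p n) {v : V} (hv : ∀ i ≤ n, p i ≠ v) {i j : ℕ}
    (hij : i + 1 < j) (hj : j < n) (h1 : G.Adj v (p (i + 1))) (h2 : G.Adj v (p j))
    (h3 : G.Adj (p i) (p (i + 2))) (h : G.Adj (p (i + 1)) (p (j + 1))) :
    G.HasPath x y (n + 1) := by
  classical
  refine hp.hasPath_of_perm hv
    (l := seg p 0 i ++ (seg p (i + 2) j ++ ([v] ++ ([p (i + 1)] ++ seg p (j + 1) n))))
    ((hp.threads_zero (by omega)).append h3 ((hp.threads_seg hij hj.le).append h2.symm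
      ((Threads.single v).append h1 ((Threads.single _).append h (hp.threads_last hj))))) ?_
  rw [← seg_append p (Nat.zero_le (i + 1)) (by omega : i ≤ n),
    ← seg_append p (by omega : i + 1 ≤ i + 1 + 1) (by omega : i + 1 ≤ n), seg_self,
    ← seg_append p (by omega : i + 1 + 1 ≤ j + 1) hj.le, List.perm_iff_count]
  intro a
  have hi2 : i + 1 + 1 = i + 2 := rfl
  simp only [List.count_append, List.count_cons, List.count_nil, hi2]
  omega

lemma hasPath_move_left (hp : G.IsPathSeq x y p n) {v : V} (hv : ∀ i ≤ n, p i ≠ v) {i j : ℕ}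
    (hij : j < i) (hi : i + 2 ≤ n) (h1 : G.Adj v (p (i + 1))) (h2 : G.Adj v (p j))
    (h3 : G.Adj (p i) (p (i + 2))) (h : G.Adj (p (i + 1)) (p (j + 1))) :
    G.HasPath x y (n + 1) := by
  classical
  refine hp.hasPath_of_perm hv
    (l := seg p 0 j ++ ([v] ++ ([p (i + 1)] ++ (seg p (j + 1) i ++ seg p (i + 2) n))))
    ((hp.threads_zero (by omega)).append h2.symm ((Threads.single v).append h1
      ((Threads.single _).append h ((hp.threads_seg hij (by omega)).append h3
        (hp.threads_last hi))))) ?_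
  rw [← seg_append p (Nat.zero_le (j + 1)) (by omega : j ≤ n),
    ← seg_append p (by omega : j + 1 ≤ i + 1) (by omega : i ≤ n),
    ← seg_append p (by omega : i + 1 ≤ i + 1 + 1) (by omega : i + 1 ≤ n), seg_self,
    List.perm_iff_count]
  intro a
  have hi2 : i + 1 + 1 = i + 2 := rfl
  simp only [List.count_append, List.count_cons, List.count_nil, hi2]
  omega

end IsPathSeq

lemma Walk.IsPath.isPathSeq {w : G.Walk x y} (hw : w.IsPath) :
    G.IsPathSeq x y w.getVert w.length :=
  ⟨w.getVert_zero, w.getVert_length, fun _ hi => w.adj_getVert_succ hi,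
    fun _ hi _ hj h => hw.getVert_injOn hi hj h⟩

lemma dist_eq_two_of_common {u v w : V} (hne : u ≠ v) (h : ¬ G.Adj u v) (h1 : G.Adj u w)
    (h2 : G.Adj w v) : G.dist u v = 2 := by
  have hle : G.dist u v ≤ 2 := dist_le (Walk.cons h1 (Walk.cons h2 Walk.nil))
  have hr : G.Reachable u v := ⟨Walk.cons h1 (Walk.cons h2 Walk.nil)⟩
  have h0 : G.dist u v ≠ 0 := fun h0 => hne (hr.dist_eq_zero_iff.1 h0)
  have h1 : G.dist u v ≠ 1 := fun h1 => h (dist_eq_one_iff_adj.1 h1)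
  omega

/-- The `L_i` condition in terms of common neighbours. -/
lemma IsLGraph.ncard_sdiff_le [G.LocallyFinite] {i : ℕ} (hL : G.IsLGraph i) {u w v : V}
    (hd : G.dist u v = 2) (hu : G.Adj u w) (hv : G.Adj v w) :
    (G.neighborSet w \ (G.neighborSet u ∪ G.neighborSet v)).ncard ≤
      (G.neighborSet u ∩ G.neighborSet v).ncard + i := by
  have h := hL u w v hd ⟨hu, hv⟩
  have hfin : ∀ a, (G.neighborSet a).Finite := fun a => Set.toFinite _
  have hdeg : ∀ a, G.degree a = (G.neighborSet a).ncard := fun a => by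
    rw [← G.card_neighborSet_eq_degree a, Set.ncard_eq_toFinset_card', Set.toFinset_card]
  have h1 := Set.ncard_union_add_ncard_inter (G.neighborSet u) (G.neighborSet v)
    (hfin u) (hfin v)
  have h2 : (G.neighborSet w \ (G.neighborSet u ∪ G.neighborSet v)).ncard +
      (G.neighborSet u ∪ G.neighborSet v).ncard =
      (G.neighborSet u ∪ G.neighborSet v ∪ G.neighborSet w).ncard := by
    rw [Set.ncard_sdiff_add_ncard _ _ (hfin w) ((hfin u).union (hfin v)), Set.union_comm]
  rw [hdeg, hdeg] at h
  omega

/-! ### Paths that cannot be lengthened -/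

section

variable [G.LocallyFinite] {p : ℕ → V} {n : ℕ}

/-- If a path cannot be prolonged by one or two vertices, then the neighbours on the path of a
vertex off the path that is not adjacent to the last vertex come in steps of two from the start. -/
lemma IsPathSeq.adj_sub_two (hp : G.IsPathSeq x y p n) (hL : G.IsLGraph 1)
    (hcommon : ∀ u v : V, G.dist u v = 2 → 2 ≤ (G.neighborSet u ∩ G.neighborSet v).ncard)
    (h1 : ¬ G.HasPath x y (n + 1)) (h2 : ¬ G.HasPath x y (n + 2))
    {v : V} (hv : ∀ i ≤ n, p i ≠ v) (hvy : ¬ G.Adj v y) {i : ℕ} (hi : i ≤ n)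
    (hvi : G.Adj v (p i)) (hi0 : i ≠ 0) : 2 ≤ i ∧ G.Adj v (p (i - 2)) := by
  classical
  -- Non-adjacency to `y` guarantees that each neighbour of `v` on the path has a successor.
  have hlt : ∀ j ≤ n, G.Adj v (p j) → j < n := fun j hj hvj =>
    lt_of_le_of_ne hj fun hjn => hvy (by rwa [← hp.last, ← hjn])
  have hins : ∀ j < n, G.Adj v (p j) → ¬ G.Adj v (p (j + 1)) := fun j hj ha hb =>
    h1 (hp.hasPath_insert hv hj ha hb)
  set J : Finset ℕ := (Finset.range n).filter fun j => G.Adj v (p j) with hJ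
  have memJ : ∀ {j}, j ∈ J ↔ j < n ∧ G.Adj v (p j) := by simp [hJ]
  have hsucc : ∀ j ∈ J, ∀ k ∈ J, ¬ G.Adj (p (j + 1)) (p (k + 1)) := by
    intro j hj k hk h
    obtain ⟨hjn, hj⟩ := memJ.1 hj
    obtain ⟨hkn, hk⟩ := memJ.1 hk
    rcases lt_trichotomy j k with hjk | rfl | hjk
    · exact h1 (hp.hasPath_of_adj_succ hv hjk hkn hj hk h)
    · exact G.irrefl h
    · exact h1 (hp.hasPath_of_adj_succ hv hjk hjn hk hj h.symm)
  have hdist : ∀ j ∈ J, G.dist v (p (j + 1)) = 2 := fun j hj =>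
    dist_eq_two_of_common (hv _ (memJ.1 hj).1).symm (hins j (memJ.1 hj).1 (memJ.1 hj).2)
      (memJ.1 hj).2 (hp.adj j (memJ.1 hj).1)
  let R : ℕ → Finset ℕ := fun j => J.filter fun k => G.Adj (p (j + 1)) (p k)
  let C : ℕ → Finset ℕ := fun j => J.filter fun k => G.Adj (p j) (p (k + 1))
  let D : ℕ → Set V := fun j =>
    G.neighborSet (p j) \ (G.neighborSet v ∪ G.neighborSet (p (j + 1)))
  have hcap : ∀ j ∈ J, (G.neighborSet v ∩ G.neighborSet (p (j + 1))).ncard ≤ (R j).card := by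
    intro j hj
    have hsub : G.neighborSet v ∩ G.neighborSet (p (j + 1)) ⊆ ((R j).image p : Finset V) := by
      rintro z ⟨hz1, hz2⟩
      rw [mem_neighborSet] at hz1 hz2
      by_cases hz : ∃ k ≤ n, p k = z
      · obtain ⟨k, hk, rfl⟩ := hz
        simp only [Finset.coe_image, Set.mem_image, Finset.mem_coe]
        exact ⟨k, Finset.mem_filter.2 ⟨memJ.2 ⟨hlt k hk hz1, hz1⟩, hz2⟩, rfl⟩
      · push Not at hz
        exact (h2 (hp.hasPath_insert_two hv hz (memJ.1 hj).1 (memJ.1 hj).2 hz1 hz2.symm)).elim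
    calc _ ≤ (((R j).image p : Finset V) : Set V).ncard := Set.ncard_le_ncard hsub
      _ = ((R j).image p).card := Set.ncard_coe_finset _
      _ ≤ (R j).card := Finset.card_image_le
  let T : ℕ → Finset V := fun j => insert v ((C j).image fun k => p (k + 1))
  have hTcard : ∀ j, (T j).card = (C j).card + 1 := by
    intro j
    rw [Finset.card_insert_of_notMem, Finset.card_image_of_injOn]
    · intro a ha b hb hab
      have ha := (memJ.1 (Finset.mem_filter.1 ha).1).1
      have hb := (memJ.1 (Finset.mem_filter.1 hb).1).1
      have := hp.inj _ ha _ hb hab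
      omega
    · rw [Finset.mem_image]
      rintro ⟨k, hk, h⟩
      exact hv _ (memJ.1 (Finset.mem_filter.1 hk).1).1 h
  have hTsub : ∀ j ∈ J, (T j : Set V) ⊆ D j := by
    intro j hj z hz
    obtain ⟨hjn, hvj⟩ := memJ.1 hj
    rw [Finset.mem_coe, Finset.mem_insert, Finset.mem_image] at hz
    rcases hz with rfl | ⟨k, hk, rfl⟩
    · refine ⟨hvj.symm, ?_⟩
      rintro (h | h)
      · exact G.irrefl h
      · exact hins j hjn hvj (Adj.symm h)
    · obtain ⟨hkJ, hjk⟩ := Finset.mem_filter.1 hk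
      refine ⟨hjk, ?_⟩
      rintro (h | h)
      · exact hins k (memJ.1 hkJ).1 (memJ.1 hkJ).2 h
      · exact hsucc j hj k hkJ h
  have hDfin : ∀ j, (D j).Finite := fun j => (Set.toFinite (G.neighborSet (p j))).sdiff
  have hDcard : ∀ j ∈ J, (D j).ncard ≤ (R j).card + 1 := fun j hj =>
    (hL.ncard_sdiff_le (hdist j hj) (memJ.1 hj).2 (hp.adj j (memJ.1 hj).1).symm).trans
      (Nat.add_le_add_right (hcap j hj) 1)
  have hCR : ∀ j ∈ J, (C j).card ≤ (R j).card := by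
    intro j hj
    have := Set.ncard_le_ncard (hTsub j hj) (hDfin j)
    rw [Set.ncard_coe_finset, hTcard] at this
    have := hDcard j hj
    omega
  -- Both sums count the pairs `(j, k)` in `J × J` with `p j` adjacent to `p (k + 1)`, so every
  -- inequality in `hCR` is an equality.
  have hsum : ∑ j ∈ J, (C j).card = ∑ j ∈ J, (R j).card := by
    simp only [C, R, Finset.card_filter]
    rw [Finset.sum_comm]
    simp only [G.adj_comm]
  have heq : ∀ j ∈ J, (C j).card = (R j).card := (Finset.sum_eq_sum_iff_of_le hCR).1 hsum
  have hDT : ∀ j ∈ J, (T j : Set V) = D j := fun j hj =>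
    Set.eq_of_subset_of_ncard_le (hTsub j hj)
      (by rw [Set.ncard_coe_finset, hTcard, heq j hj]; exact hDcard j hj) (hDfin j)
  obtain ⟨i, rfl⟩ := Nat.exists_eq_succ_of_ne_zero hi0
  have hin := hlt _ hi hvi
  have hiJ : i + 1 ∈ J := memJ.2 ⟨hin, hvi⟩
  have hvpred : ¬ G.Adj v (p i) := fun h => hins i (by omega) h hvi
  -- With the chord, `|C (i + 1)| ≥ 2` gives a second place to reinsert `p (i + 1)` along with `v`.
  -- Without it, `p i` lies in `D (i + 1)`, so it is the successor of a neighbour of `v`.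
  by_cases hskip : G.Adj (p i) (p (i + 2))
  · exfalso
    have hC2 : 1 < (C (i + 1)).card := by
      rw [heq _ hiJ]
      exact (hcommon _ _ (hdist _ hiJ)).trans (hcap _ hiJ)
    obtain ⟨j, hj, hne⟩ := Finset.exists_mem_ne hC2 (i + 1)
    obtain ⟨hjJ, hadj⟩ := Finset.mem_filter.1 hj
    obtain ⟨hjn, hvj⟩ := memJ.1 hjJ
    rcases lt_or_gt_of_ne hne with hlt' | hgt
    · have hji : j ≠ i := by rintro rfl; exact hvpred hvj
      exact h1 (hp.hasPath_move_left hv (by omega) hin hvi hvj hskip hadj)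
    · exact h1 (hp.hasPath_move_right hv hgt hjn hvi hvj hskip hadj)
  · have hmem : p i ∈ D (i + 1) := by
      refine ⟨(hp.adj i (by omega)).symm, ?_⟩
      rintro (h | h)
      · exact hvpred h
      · exact hskip (Adj.symm h)
    rw [← hDT _ hiJ, Finset.mem_coe, Finset.mem_insert, Finset.mem_image] at hmem
    rcases hmem with h | ⟨k, hk, h⟩
    · exact (hv i (by omega) h).elim
    · obtain ⟨hkn, hvk⟩ := memJ.1 (Finset.mem_filter.1 hk).1
      have := hp.inj _ hkn _ (by omega) h
      subst this
      exact ⟨by omega, by simpa using hvk⟩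

/-- Under the same hypotheses the vertex is adjacent to the first and to the third vertex of the
path. -/
lemma IsPathSeq.adj_first_third (hp : G.IsPathSeq x y p n) (hL : G.IsLGraph 1)
    (hcommon : ∀ u v : V, G.dist u v = 2 → 2 ≤ (G.neighborSet u ∩ G.neighborSet v).ncard)
    (h1 : ¬ G.HasPath x y (n + 1)) (h2 : ¬ G.HasPath x y (n + 2))
    {v : V} (hv : ∀ i ≤ n, p i ≠ v) (hvy : ¬ G.Adj v y) {i : ℕ} (hi : i ≤ n)
    (hvi : G.Adj v (p i)) : G.Adj v x ∧ 2 < n ∧ G.Adj v (p 2) := by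
  have hlt : ∀ j ≤ n, G.Adj v (p j) → j < n := fun j hj hvj =>
    lt_of_le_of_ne hj fun hjn => hvy (by rwa [← hp.last, ← hjn])
  have hstep : ∀ j ≤ n, G.Adj v (p j) → j ≠ 0 → 2 ≤ j ∧ G.Adj v (p (j - 2)) :=
    fun j hj hvj => hp.adj_sub_two hL hcommon h1 h2 hv hvy hj hvj
  have hx : ∀ j ≤ n, G.Adj v (p j) → G.Adj v x := by
    intro j
    induction j using Nat.strong_induction_on with
    | _ j ih =>
      intro hj hvj
      rcases eq_or_ne j 0 with rfl | hj0
      · rwa [hp.zero] at hvj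
      · obtain ⟨h, h'⟩ := hstep j hj hvj hj0
        exact ih (j - 2) (by omega) (by omega) h'
  have hvx := hx i hi hvi
  have h0 : G.Adj v (p 0) := by rwa [hp.zero]
  have hn : 0 < n := hlt 0 (by omega) h0
  have h2' : ∀ j ≤ n, G.Adj v (p j) → j ≠ 0 → G.Adj v (p 2) ∧ 2 ≤ n := by
    intro j
    induction j using Nat.strong_induction_on with
    | _ j ih =>
      intro hj hvj hj0
      obtain ⟨h, h'⟩ := hstep j hj hvj hj0
      rcases eq_or_ne j 2 with rfl | hj2
      · exact ⟨hvj, hj⟩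
      · exact ih (j - 2) (by omega) (by omega) h' (by omega)
  have hv1 : ¬ G.Adj v (p 1) := fun h => h1 (hp.hasPath_insert hv hn h0 h)
  -- A second common neighbour of `v` and `p 1` besides `x` lies on the path, and descending from it
  -- reaches `p 2`.
  have hd := hcommon _ _
    (dist_eq_two_of_common (hv 1 hn).symm hv1 h0 (hp.adj 0 hn))
  obtain ⟨z, ⟨hz1, hz2⟩, hzx⟩ := Set.exists_ne_of_one_lt_ncard hd x
  rw [mem_neighborSet] at hz1 hz2
  obtain ⟨j, hj, rfl⟩ : ∃ j ≤ n, p j = z := by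
    by_contra! hz
    exact h2 (hp.hasPath_insert_two hv hz hn h0 hz1 hz2.symm)
  obtain ⟨h3, h4⟩ := h2' j hj hz1 (by rintro rfl; exact hzx hp.zero)
  exact ⟨hvx, hlt 2 h4 h3, h3⟩

/-- If a path cannot be prolonged, then the neighbours of a vertex off the path that is adjacent to
the path but not to its last vertex lie on the path. -/
lemma IsPathSeq.mem_of_adj_of_not_adj_last (hp : G.IsPathSeq x y p n) (hL : G.IsLGraph 1)
    (hcommon : ∀ u v : V, G.dist u v = 2 → 2 ≤ (G.neighborSet u ∩ G.neighborSet v).ncard)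
    (hxy : G.neighborSet x ∩ G.neighborSet y = ∅)
    (h1 : ¬ G.HasPath x y (n + 1)) (h2 : ¬ G.HasPath x y (n + 2))
    {v : V} (hv : ∀ i ≤ n, p i ≠ v) (hvy : ¬ G.Adj v y) {i : ℕ} (hi : i ≤ n)
    (hvi : G.Adj v (p i)) {z : V} (hvz : G.Adj v z) : ∃ j ≤ n, p j = z := by
  by_contra! hz
  obtain ⟨hvx, hn, hv2⟩ := hp.adj_first_third hL hcommon h1 h2 hv hvy hi hvi
  have hv0 : G.Adj v (p 0) := by rwa [hp.zero]
  have hq : G.IsPathSeq x y (Function.update p 1 v) n := by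
    refine ⟨by simp [hp.zero], ?_, fun j hj => ?_, fun j hj k hk h => ?_⟩
    · rw [Function.update_of_ne (by omega), hp.last]
    · rcases eq_or_ne j 0 with rfl | hj0
      · simpa using hv0.symm
      rcases eq_or_ne j 1 with rfl | hj1
      · simpa using hv2
      · rw [Function.update_of_ne hj1, Function.update_of_ne (by omega)]
        exact hp.adj j hj
    · rcases eq_or_ne j 1 with rfl | hj1 <;> rcases eq_or_ne k 1 with rfl | hk1
      · rfl
      · rw [Function.update_self, Function.update_of_ne hk1] at h
        exact (hv k hk h.symm).elim
      · rw [Function.update_self, Function.update_of_ne hj1] at h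
        exact (hv j hj h).elim
      · rw [Function.update_of_ne hj1, Function.update_of_ne hk1] at h
        exact hp.inj j hj k hk h
  have hzq : ∀ j ≤ n, Function.update p 1 v j ≠ z := by
    intro j hj
    rcases eq_or_ne j 1 with rfl | hj1
    · simpa using hvz.ne
    · simpa [Function.update_of_ne hj1] using hz j hj
  have hzq1 : G.Adj z (Function.update p 1 v 1) := by simpa using hvz.symm
  by_cases hzy : G.Adj z y
  · have hzx : ¬ G.Adj z x := fun h => by
      have : z ∈ G.neighborSet x ∩ G.neighborSet y := ⟨h.symm, hzy.symm⟩
      simp [hxy] at this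
    -- Seen from `y`, the step of two leads from `v` in position 1 to `p 3`; then `v, z` fit between
    -- `p 2` and `p 3`.
    obtain ⟨-, h⟩ := hq.reverse.adj_sub_two hL hcommon (fun h => h1 h.symm) (fun h => h2 h.symm)
      (fun j _ => hzq _ (by omega)) hzx (i := n - 1) (by omega)
      (by simpa [show n - (n - 1) = 1 by omega] using hzq1) (by omega)
    rw [show n - (n - 1 - 2) = 3 by omega, Function.update_of_ne (by omega)] at h
    exact h2 (hp.hasPath_insert_two hv hz hn hv2 hvz h)
  · obtain ⟨hzx, -, -⟩ := hq.adj_first_third hL hcommon h1 h2 hzq hzy (by omega) hzq1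
    exact h1 (hq.hasPath_insert hzq (i := 0) (by omega) (by simpa [hp.zero] using hzx) hzq1)

/-- In a connected infinite graph every path between `x` and `y` yields one with one or two more
vertices. -/
lemma HasPath.prolong [Infinite V] (hconn : G.Connected) (hL : G.IsLGraph 1)
    (hcommon : ∀ u v : V, G.dist u v = 2 → 2 ≤ (G.neighborSet u ∩ G.neighborSet v).ncard)
    (hxy : G.neighborSet x ∩ G.neighborSet y = ∅) {n : ℕ} (h : G.HasPath x y n) :
    G.HasPath x y (n + 1) ∨ G.HasPath x y (n + 2) := by
  by_contra! hcon
  obtain ⟨h1, h2⟩ := hcon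
  obtain ⟨w, hw, rfl⟩ := h
  have hp := hw.isPathSeq
  set p := w.getVert
  set n := w.length
  let A : Set V := p '' Set.Iic n
  let B : Set V := A ∪ G.neighborSet x ∪ G.neighborSet y
  have hB : B.Finite :=
    (((Set.finite_Iic n).image p).union (Set.toFinite (G.neighborSet x))).union
      (Set.toFinite (G.neighborSet y))
  have hor : ∀ v, (∀ i ≤ n, p i ≠ v) → ∀ i ≤ n, G.Adj v (p i) →
      (G.Adj v x ∨ G.Adj v y) ∧ ∀ z, G.Adj v z → z ∈ A := by
    intro v hv i hi hvi
    by_cases hvy : G.Adj v y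
    · have hvx : ¬ G.Adj v x := fun h => by
        have : v ∈ G.neighborSet x ∩ G.neighborSet y := ⟨h.symm, hvy.symm⟩
        simp [hxy] at this
      refine ⟨Or.inr hvy, fun z hz => ?_⟩
      obtain ⟨j, -, rfl⟩ := hp.reverse.mem_of_adj_of_not_adj_last hL hcommon
        (by rwa [Set.inter_comm]) (fun h => h1 h.symm) (fun h => h2 h.symm)
        (fun j _ => hv _ (by omega)) hvx (i := n - i) (by omega)
        (by simpa [show n - (n - i) = i by omega] using hvi) hz
      exact ⟨n - j, Set.mem_Iic.2 (by omega), rfl⟩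
    · refine ⟨Or.inl (hp.adj_first_third hL hcommon h1 h2 hv hvy hi hvi).1, fun z hz => ?_⟩
      obtain ⟨j, hj, rfl⟩ :=
        hp.mem_of_adj_of_not_adj_last hL hcommon hxy h1 h2 hv hvy hi hvi hz
      exact ⟨j, hj, rfl⟩
  have hclosed : ∀ a ∈ B, ∀ b, G.Adj a b → b ∈ B := by
    intro a ha b hab
    by_cases hbA : b ∈ A
    · exact Or.inl (Or.inl hbA)
    have hb : ∀ i ≤ n, p i ≠ b := fun i hi h => hbA ⟨i, hi, h⟩
    have hA : a ∈ A := by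
      by_contra haA
      have ha' : ∀ i ≤ n, p i ≠ a := fun i hi h => haA ⟨i, hi, h⟩
      rcases ha with (ha | ha) | ha
      · exact haA ha
      · exact hbA ((hor a ha' 0 (Nat.zero_le n) (by rw [hp.zero]; exact Adj.symm ha)).2 b hab)
      · exact hbA ((hor a ha' n le_rfl (by rw [hp.last]; exact Adj.symm ha)).2 b hab)
    obtain ⟨i, hi, rfl⟩ := hA
    rcases (hor b hb i hi hab.symm).1 with h | h
    · exact Or.inl (Or.inr h.symm)
    · exact Or.inr h.symm
  have hx : x ∈ B := Or.inl (Or.inl ⟨0, Set.mem_Iic.2 (Nat.zero_le n), hp.zero⟩)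
  have hall : ∀ a b, G.Walk a b → a ∈ B → b ∈ B := by
    intro a b q
    induction q with
    | nil => exact id
    | cons hab _ ih => exact fun ha => ih (hclosed _ ha _ hab)
  refine Set.infinite_univ (hB.subset fun b _ => ?_)
  obtain ⟨q⟩ := hconn.preconnected x b
  exact hall x b q hx

end

end SimpleGraph

theorem corollary9 {V : Type*} [Infinite V] (G : SimpleGraph V) [G.LocallyFinite]
    (hconn : G.Connected) (hL : G.IsLGraph 1)
    (hcommon : ∀ u v : V, G.dist u v = 2 → 2 ≤ (G.neighborSet u ∩ G.neighborSet v).ncard)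
    (x y : V) (hxy : G.neighborSet x ∩ G.neighborSet y = ∅)
    (m : ℕ) (hm : G.dist x y + 1 ≤ m) :
    ∃ p : G.Walk x y, p.IsPath ∧ (p.support.length = m ∨ p.support.length = m - 1) := by
  -- Here `k` counts edges, so `k = m - 1`; the clause `1 ≤ k` keeps `k - 1` from truncating.
  have key : ∀ k, G.dist x y ≤ k → G.HasPath x y k ∨ (G.HasPath x y (k - 1) ∧ 1 ≤ k) := by
    intro k hk
    induction k, hk using Nat.le_induction with
    | base =>
      obtain ⟨p, hp, hlen⟩ := hconn.exists_path_of_dist x y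
      exact Or.inl ⟨p, hp, hlen⟩
    | succ k hk ih =>
      rcases ih with h | ⟨h, hk1⟩
      · exact Or.inr ⟨h, by omega⟩
      · obtain ⟨k, rfl⟩ := Nat.exists_eq_add_of_le' hk1
        rcases h.prolong hconn hL hcommon hxy with h | h
        · exact Or.inr ⟨h, by omega⟩
        · exact Or.inl h
  rcases key (m - 1) (by omega) with ⟨p, hp, hlen⟩ | ⟨⟨p, hp, hlen⟩, h1⟩
  · exact ⟨p, hp, Or.inl (by rw [SimpleGraph.Walk.length_support]; omega)⟩
  · exact ⟨p, hp, Or.inr (by rw [SimpleGraph.Walk.length_support]; omega)⟩
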